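/- \textbf{System.} There are $n=3f+1$ replicas, $c\le f$ of which are faulty; the others are honest. Time starts at $0$; rounds $1,2,\dots$ last $2\Delta$ each (lock-step), and round $r$ has the round-robin leader $L_r = r \bmod n$. The network is partially synchronous with authenticated channels: a message multicast by an honest replica at time $t$ reaches every honest replica by time $\max(\mathrm{GST},t)+\Delta$, transmission takes positive time, and signatures cannot be forged. Honest replicas forward every message that they receive. \textbf{Blocks.} A non-genesis block contains its parent (by an ideal hash), a strong-QC for the parent, its round number and transactions; its height is its distance from the genesis block (round $0$, height $0$). A strong-QC consists of strong-votes of $2f+1$ distinct replicas for the parent (it is empty if the parent is the genesis block). $B$ \emph{extends} $A$ if $A$ is an ancestor of $B$ or $A=B$; two blocks \emph{conflict} if neither extends the other. A block is \emph{certified} (in a replica's view) if the replica has seen votes for it, directly or inside strong-QCs, of at least $2f+1$ distinct replicas; the genesis block is certified by convention. A chain is certified if all its blocks are. \textbf{SFT-Streamlet.} At the start of round $r$ the leader multicasts one proposal of a round-$r$ block whose parent is the last block of a longest certified chain that it knows. On receiving the first round-$r$ proposal $B$ during round $r$, a replica multicasts the strong-vote $\langle\mathtt{vote},B,r,\mathit{marker}\rangle$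 if and only if $B$ extends a longest certified chain that it knows; $\mathit{marker}$ is the largest height of a block conflicting with $B$ that it has voted for ($0$ if there is none). A strong-vote for $B'$ \emph{$k$-endorses} $B$ if $B=B'$, or $B'$ extends $B$ and $\mathit{marker}<k$; its sender is then a $k$-endorser of $B$, and all replicas endorse the genesis block by convention. A replica \emph{commits} $B_k$ and all its ancestors if there are three adjacent certified blocks $B_{k-1},B_k,B_{k+1}$ with consecutive round numbers. It \emph{$x$-strong commits} $B_k$ (of height $k$) and all its ancestors if there are three adjacent blocks $B_{k-1},B_k,B_{k+1}$ with consecutive round numbers, each of which has at least $x+f+1$ $k$-endorsers among the strong-votes that it has seen. \textbf{Theorem.} Let $R\ge 1$ be a round that starts at or after GST, and suppose that in the $n+2$ rounds $R,\dots,R+n+1$ all $c\le f$ faults are crash faults: as regards the proposals and votes of these rounds, and the forwarding of the messages received during them, every faulty replica $i$ follows the protocol until a time $\tau_i\in\mathbb R\cup\{\infty\}$ and then stops. (A multicast of a vote or a forwarded message at the instant $\tau_i$ may reach only some replicas; a leader with $\tau_i$ not later than the start of its round proposes nothing.) Outside of these rounds the faulty replicas may be Byzantine. Let $T$ be the end of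 round $R+n+1$. Then: (1) every block that an honest replica has committed by time $T$ has been $(2f-c)$-strong committed by the same replica by time $T$; (2) every block that some honest replica has committed by a time $t\le T-\Delta$ (in particular every block committed by the start of the period) has been $(2f-c)$-strong committed by every honest replica by time $T$. In particular, any committed block becomes $(2f-c)$-strong committed within $n+2$ rounds. -/

import Mathlib

namespace SFTStreamlet

/-- The `n = 3f + 1` replicas. -/
abbrev Replica (f : ℕ) : Type := Fin (3 * f + 1)

/-- The round-robin leader of round `r`. -/
def leader (f r : ℕ) : Replica f := ⟨r % (3 * f + 1), Nat.mod_lt _ (Nat.succ_pos _)⟩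

/-- Blocks. A non-genesis block holds its parent (hashes are ideal, so the digest of the parent is
the parent itself), a strong-QC for the parent, its round number and a batch of transactions.
`qc j = some μ` says that the strong-QC contains the strong-vote `⟨vote, parent, parent.round, μ⟩_j`
signed by `j`, with marker `μ`. -/
inductive Block (f : ℕ) (Txn : Type*) where
  | genesis : Block f Txn
  | mk (parent : Block f Txn) (qc : Replica f → Option ℕ) (round : ℕ) (txn : Txn) : Block f Txn

namespace Block

variable {f : ℕ} {Txn : Type*}

/-- The position in the chain; the genesis block has height `0`. -/
def height : Block f Txn → ℕ
  | genesis => 0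
  | mk p _ _ _ => p.height + 1

/-- The round number; the genesis block has round `0`, the protocol rounds are `1, 2, …`. -/
def round : Block f Txn → ℕ
  | genesis => 0
  | mk _ _ r _ => r

/-- `P.IsParentOf B`: `P` is the parent of `B`. -/
def IsParentOf (P : Block f Txn) : Block f Txn → Prop
  | genesis => False
  | mk p _ _ _ => P = p

/-- `B.Extends A`: `A` is an ancestor of `B`, or `B` itself. -/
def Extends : Block f Txn → Block f Txn → Prop
  | genesis, A => A = genesis
  | mk p qc r x, A => A = mk p qc r x ∨ p.Extends A

/-- Two blocks conflict if neither extends the other. -/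
def Conflicts (A B : Block f Txn) : Prop := ¬ A.Extends B ∧ ¬ B.Extends A

/-- The strong-QC of every block on the chain consists of `2f + 1` strong-votes of distinct
replicas. The genesis block needs no votes, so the QC of a block of height `1` is empty. -/
def WellFormed : Block f Txn → Prop
  | genesis => True
  | mk genesis qc _ _ => ∀ j, qc j = none
  | mk (mk p qc' r x) qc _ _ =>
      {j | qc j ≠ none}.ncard = 2 * f + 1 ∧ (mk p qc' r x).WellFormed

/-- The chain ending in `B` contains, in the strong-QC of one of its blocks, the strong-vote of
replica `j` for the block `A` with marker `μ`. -/
def ContainsVote : Block f Txn → Replica f → Block f Txn → ℕ → Prop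
  | genesis, _, _, _ => False
  | mk p qc _ _, j, A, μ => (A = p ∧ qc j = some μ) ∨ p.ContainsVote j A μ

end Block

/-- Signed messages: `propose B` is `⟨propose, B, B.round⟩` signed by the leader of round `B.round`,
and `vote j B μ` is the strong-vote `⟨vote, B, B.round, μ⟩` signed by `j`, with marker `μ`. -/
inductive Msg (f : ℕ) (Txn : Type*) where
  | propose (B : Block f Txn) : Msg f Txn
  | vote (j : Replica f) (B : Block f Txn) (μ : ℕ) : Msg f Txn

namespace Msg

variable {f : ℕ} {Txn : Type*}

/-- The block a message is about. -/
def block : Msg f Txn → Block f Txn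
  | propose B => B
  | vote _ B _ => B

/-- `m.Carries j A μ`: the message `m` is, or contains in a strong-QC, the strong-vote of `j` for
`A` with marker `μ`. -/
def Carries (m : Msg f Txn) (j : Replica f) (A : Block f Txn) (μ : ℕ) : Prop :=
  m = vote j A μ ∨ m.block.ContainsVote j A μ

end Msg

/-- What happens in a run of the system, in continuous time that starts at `0`. The laws of the
network and of the protocol are stated in `Execution.Valid`. -/
structure Execution (f : ℕ) (Txn : Type*) where
  /-- the known bound on the network delay -/
  Δ : ℝ
  /-- the global stabilization time -/
  GST : ℝ
  /-- the faulty replicas; all the others are honest -/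
  faulty : Finset (Replica f)
  /-- the time at which a replica first receives a message (`⊤` if it never does) -/
  recvTime : Replica f → Msg f Txn → WithTop ℝ
  /-- `proposes B t`: the leader of round `B.round` signs and sends its proposal of `B` at `t` -/
  proposes : Block f Txn → ℝ → Prop
  /-- `votes j B μ t`: replica `j` signs and sends its strong-vote for `B` with marker `μ` at `t` -/
  votes : Replica f → Block f Txn → ℕ → ℝ → Prop

namespace Execution

variable {f : ℕ} {Txn : Type*} (e : Execution f Txn)

/-- Rounds advance in lock-step and last `2Δ` each; round `1` starts at time `0`. -/
noncomputable def roundStart (r : ℕ) : ℝ := 2 * e.Δ * ((r : ℝ) - 1)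

/-- Time `t` belongs to round `r ≥ 1`. -/
def InRound (r : ℕ) (t : ℝ) : Prop :=
  1 ≤ r ∧ e.roundStart r ≤ t ∧ t < e.roundStart (r + 1)

/-! ### The local view of a replica -/

/-- By time `t` replica `i` has seen the strong-vote of `j` for `A` with marker `μ`. -/
def SeesVote (i : Replica f) (t : ℝ) (j : Replica f) (A : Block f Txn) (μ : ℕ) : Prop :=
  ∃ m : Msg f Txn, e.recvTime i m ≤ (t : WithTop ℝ) ∧ m.Carries j A μ

/-- By time `t` replica `i` has seen votes for `B` of `2f + 1` distinct replicas. The genesis block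
is certified by convention. -/
def Certified (i : Replica f) (t : ℝ) (B : Block f Txn) : Prop :=
  B = Block.genesis ∨ 2 * f + 1 ≤ {j | ∃ μ, e.SeesVote i t j B μ}.ncard

/-- The chain ending in `B` is a certified chain in the view of `i` at time `t`. -/
def CertifiedChain (i : Replica f) (t : ℝ) (B : Block f Txn) : Prop :=
  ∀ A, B.Extends A → e.Certified i t A

/-- `B` is the last block of one of the longest certified chains known to `i` at time `t`. -/
def LongestCertified (i : Replica f) (t : ℝ) (B : Block f Txn) : Prop :=
  e.CertifiedChain i t B ∧ ∀ B', e.CertifiedChain i t B' → B'.height ≤ B.height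

/-! ### The protocol rules -/

/-- Proposing rule: in round `r` replica `i` may propose `B`, a well-formed block of round `r` that
extends by one block a longest certified chain known to `i` at the start of the round, and
whose strong-QC is made of strong-votes that `i` has seen. -/
def ProposeRule (i : Replica f) (r : ℕ) (B : Block f Txn) : Prop :=
  ∃ P qc x, B = Block.mk P qc r x ∧ B.WellFormed ∧
    e.LongestCertified i (e.roundStart r) P ∧
    ∀ j μ, qc j = some μ → e.SeesVote i (e.roundStart r) j P μ

/-- `μ` is the largest height of a block that conflicts with `B` and for which `i` voted before
time `t`, or `0` if there is none. -/
def IsMarker (i : Replica f) (t : ℝ) (B : Block f Txn) (μ : ℕ) : Prop :=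
  IsGreatest (insert 0 {h | ∃ B' μ' s, s < t ∧ e.votes i B' μ' s ∧ B'.Conflicts B ∧
    h = B'.height}) μ

/-- Voting rule: at time `t`, during round `B.round`, replica `i` receives the proposal of `B`, it
is the first proposal of that round received during the round, and `B` extends one of the longest
certified chains known to `i`; the vote carries the marker. -/
def VoteRule (i : Replica f) (B : Block f Txn) (μ : ℕ) (t : ℝ) : Prop :=
  e.InRound B.round t ∧
  e.recvTime i (Msg.propose B) = (t : WithTop ℝ) ∧
  (∀ B' : Block f Txn, B'.round = B.round →
    (e.roundStart B.round : WithTop ℝ) ≤ e.recvTime i (Msg.propose B') →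
    (t : WithTop ℝ) ≤ e.recvTime i (Msg.propose B')) ∧
  (∃ C, e.LongestCertified i t C ∧ B.Extends C) ∧
  e.IsMarker i t B μ

/-- A message multicast at time `t` reaches every honest replica within `Δ`, counted from GST if it
was sent earlier. -/
def Delivered (m : Msg f Txn) (t : ℝ) : Prop :=
  ∀ j, j ∉ e.faulty → e.recvTime j m ≤ ((max e.GST t + e.Δ : ℝ) : WithTop ℝ)

/-- In round `r` replica `i` follows the protocol until it stops at time `τ` (never, if `τ = ⊤`).
A multicast of a vote or an echo that happens at the very instant `τ` may be cut short: it may reach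
any set of replicas, or none. A leader that stops by the start of its round proposes nothing. -/
structure FollowsRound (i : Replica f) (r : ℕ) (τ : WithTop ℝ) : Prop where
  /-- an active leader multicasts exactly one proposal, at the start of the round -/
  propose : leader f r = i → (e.roundStart r : WithTop ℝ) < τ →
    ∃ B, e.ProposeRule i r B ∧ e.Delivered (Msg.propose B) (e.roundStart r) ∧
      ∀ B' t, B'.round = r → (e.proposes B' t ↔ B' = B ∧ t = e.roundStart r)
  /-- a leader that has stopped makes no proposal -/
  no_propose : leader f r = i → τ ≤ (e.roundStart r : WithTop ℝ) →
    ∀ B t, B.round = r → ¬ e.proposes B t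
  /-- every vote obeys the voting rule, and none is sent after `τ` -/
  vote_sound : ∀ B μ t, B.round = r → e.votes i B μ t →
    e.VoteRule i B μ t ∧ (t : WithTop ℝ) ≤ τ
  /-- before `τ`, the replica votes, and multicasts its vote, whenever the voting rule tells it to -/
  vote : ∀ B μ t, B.round = r → e.VoteRule i B μ t → (t : WithTop ℝ) < τ →
    e.votes i B μ t ∧ e.Delivered (Msg.vote i B μ) t
  /-- before `τ`, the replica forwards every message it receives in the round to all replicas -/
  echo : ∀ m t, e.InRound r t → (t : WithTop ℝ) < τ → e.recvTime i m = (t : WithTop ℝ) →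
    e.Delivered m t

/-- The laws of an execution of SFT-Streamlet over a partially synchronous network with
authenticated channels. Nothing but unforgeability restricts the faulty replicas. -/
structure Valid : Prop where
  delta_pos : 0 < e.Δ
  /-- nothing is received before the start -/
  recv_nonneg : ∀ i m, 0 ≤ e.recvTime i m
  /-- a replica receives one message at a time -/
  recv_inj : ∀ i m m', e.recvTime i m = e.recvTime i m' → e.recvTime i m ≠ ⊤ → m = m'
  /-- messages about ill-formed blocks are discarded -/
  recv_wellFormed : ∀ i m, e.recvTime i m ≠ ⊤ → m.block.WellFormed
  /-- a received proposal was signed earlier by the leader of its round -/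
  auth_propose : ∀ i B (t : ℝ), e.recvTime i (Msg.propose B) = (t : WithTop ℝ) →
    ∃ s, s < t ∧ e.proposes B s
  /-- a received vote, also one inside a strong-QC, was signed earlier by its sender -/
  auth_vote : ∀ i m (t : ℝ), e.recvTime i m = (t : WithTop ℝ) →
    ∀ j A μ, m.Carries j A μ → ∃ s, s < t ∧ e.votes j A μ s
  /-- honest replicas follow the protocol in all rounds -/
  honest : ∀ i, i ∉ e.faulty → ∀ r, 1 ≤ r → e.FollowsRound i r ⊤
  /-- there is no round `0` to vote in -/
  honest_zero : ∀ i, i ∉ e.faulty → ∀ B μ t, B.round = 0 → ¬ e.votes i B μ t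

/-! ### Commit rules -/

/-- Regular commit rule: by time `t` replica `i` has committed `A`, because `A` is, or is an ancestor
of, the middle block of three adjacent certified blocks with consecutive round numbers. -/
def Committed (i : Replica f) (t : ℝ) (A : Block f Txn) : Prop :=
  ∃ P B C, B.Extends A ∧ P.IsParentOf B ∧ B.IsParentOf C ∧
    B.round = P.round + 1 ∧ C.round = B.round + 1 ∧
    e.Certified i t P ∧ e.Certified i t B ∧ e.Certified i t C

/-- The `k`-endorsers of `B` in the view of `i` at time `t`: the replicas of which `i` has seen a
strong-vote for `B`, or for a block that extends `B` with marker below `k`. Just as it is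
certified, the genesis block is endorsed by all replicas by convention. -/
def endorsers (i : Replica f) (t : ℝ) (k : ℕ) (B : Block f Txn) : Set (Replica f) :=
  {j | B = Block.genesis ∨
    ∃ B' μ, e.SeesVote i t j B' μ ∧ (B = B' ∨ (B'.Extends B ∧ μ < k))}

/-- Strong commit rule: by time `t` replica `i` has `x`-strong committed `A`, because `A` is, or is an
ancestor of, the middle block of three adjacent blocks with consecutive round numbers that all
have at least `x + f + 1` `k`-endorsers, where `k` is the height of the middle block. -/
def StrongCommitted (i : Replica f) (t : ℝ) (x : ℕ) (A : Block f Txn) : Prop :=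
  ∃ P B C, B.Extends A ∧ P.IsParentOf B ∧ B.IsParentOf C ∧
    B.round = P.round + 1 ∧ C.round = B.round + 1 ∧
    x + f + 1 ≤ (e.endorsers i t B.height P).ncard ∧
    x + f + 1 ≤ (e.endorsers i t B.height B).ncard ∧
    x + f + 1 ≤ (e.endorsers i t B.height C).ncard

end Execution

end SFTStreamlet

/-! A direct vote is an endorsement, so a committed block is already `f`-strong committed. This
settles `c = f`, where `2f - c = f`; for claim (2), forwarding spreads the votes within `Δ`. If `c <
f`, the threshold `(2f - c) + f + 1` is the number `n - c` of honest replicas. It then suffices to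
find three adjacent blocks of consecutive rounds, the middle one extending the committed block, that
all honest replicas vote for directly; markers play no role.

The key notion is `Settled`: at the start of the round every honest replica knows a certified chain
at least as high as all blocks of earlier rounds that ever gather a quorum. In a settled round of
the period a block with a quorum is higher than all earlier ones. Its proposal reaches every honest
replica, even if its leader is faulty, so all of them vote for it (`seenByHonest_of_hasQuorum`) and
the next round is settled again (`settled_succ`). The first settled round comes from an honest
leader after round `R`: by then honest replicas lag by at most one block, and its proposal closes
the gap (`settled_of_honest_leader`).

Counting yields honest leaders in rounds `a < b`, `b + 1`, `b + 2`. If the committing triple lies in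
rounds from `b` on, its own blocks have all honest votes. Otherwise the blocks of rounds `b`, `b +
1`, `b + 2` form a new triple, whose middle block extends the committed one by Streamlet safety
(`extends_of_height_le`). -/

namespace SFTStreamlet

/-! ### Ancestry, heights and quorums inside chains -/

namespace Block

variable {f : ℕ} {Txn : Type*}

theorem extends_refl (B : Block f Txn) : B.Extends B := by
  cases B <;> simp [Extends]

theorem Extends.trans {A B C : Block f Txn} (h : C.Extends B) (h' : B.Extends A) :
    C.Extends A := by
  induction C with
  | genesis => simp only [Extends] at h; subst h; exact h'
  | mk p qc r x ih =>
    rcases h with h | h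
    · subst h; exact h'
    · exact Or.inr (ih h)

theorem Extends.height_le {A B : Block f Txn} (h : B.Extends A) : A.height ≤ B.height := by
  induction B with
  | genesis => simp only [Extends] at h; subst h; exact le_rfl
  | mk p qc r x ih =>
    rcases h with h | h
    · subst h; exact le_rfl
    · exact (ih h).trans (Nat.le_succ _)

theorem Extends.eq_of_height_le {A B : Block f Txn} (h : B.Extends A)
    (hh : B.height ≤ A.height) : A = B := by
  cases B with
  | genesis => exact h
  | mk p qc r x =>
    rcases h with h | h
    · exact h
    · have := Extends.height_le h
      simp only [height] at hh
      omega

theorem exists_ancestor (B : Block f Txn) {k : ℕ} (hk : k ≤ B.height) :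
    ∃ A, B.Extends A ∧ A.height = k := by
  induction B with
  | genesis => exact ⟨genesis, rfl, by simp only [height] at hk ⊢; omega⟩
  | mk p qc r x ih =>
    rcases Nat.lt_or_ge p.height k with h | h
    · exact ⟨_, extends_refl _, by simp only [height] at hk ⊢; omega⟩
    · obtain ⟨A, hA, hAk⟩ := ih h
      exact ⟨A, Or.inr hA, hAk⟩

theorem WellFormed.parent {p : Block f Txn} {qc : Replica f → Option ℕ} {r : ℕ} {x : Txn}
    (h : (mk p qc r x).WellFormed) : p.WellFormed := by
  cases p with
  | genesis => trivial
  | mk => exact h.2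

/-- The chain of a well-formed block contains a quorum of votes for each of its proper
ancestors. -/
theorem WellFormed.quorum {p A : Block f Txn} {qc : Replica f → Option ℕ} {r : ℕ} {x : Txn}
    (h : (mk p qc r x).WellFormed) (hA : p.Extends A) :
    A = genesis ∨ 2 * f + 1 ≤ {j | ∃ μ, (mk p qc r x).ContainsVote j A μ}.ncard := by
  induction p generalizing qc r x with
  | genesis => exact Or.inl hA
  | mk p' qc' r' x' ih =>
    rcases hA with rfl | hA
    · right
      rw [← h.1]
      refine Set.ncard_le_ncard (fun j hj => ?_) (Set.toFinite _)
      obtain ⟨μ, hμ⟩ := Option.ne_none_iff_exists'.1 hj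
      exact ⟨μ, Or.inl ⟨rfl, hμ⟩⟩
    · rcases ih h.parent hA with rfl | h'
      · exact Or.inl rfl
      · right
        refine h'.trans (Set.ncard_le_ncard ?_ (Set.toFinite _))
        rintro j ⟨μ, hμ⟩
        exact ⟨μ, Or.inr hμ⟩

theorem ne_genesis_of_round_pos {B : Block f Txn} (h : 1 ≤ B.round) : B ≠ genesis := by
  rintro rfl
  simp [round] at h

end Block

/-! ### Counting: heights, quorum intersection, honest leaders -/

/-- A predicate that holds for at most one block of each round bounds the height of the blocks of
the first `r` rounds, and the bound is attained unless it is `0`. -/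
theorem exists_max_height {f : ℕ} {Txn : Type*} {p : Block f Txn → Prop}
    (hp : ∀ A B, p A → p B → A.round = B.round → A = B) (r : ℕ) :
    ∃ h, (∀ B, p B → B.round < r → B.height ≤ h) ∧
      (h = 0 ∨ ∃ B, p B ∧ B.round < r ∧ B.height = h) := by
  induction r with
  | zero => exact ⟨0, fun _ _ h => absurd h (Nat.not_lt_zero _), Or.inl rfl⟩
  | succ r ih =>
    obtain ⟨h, hle, hatt⟩ := ih
    by_cases hY : ∃ Y, p Y ∧ Y.round = r ∧ h ≤ Y.height
    · obtain ⟨Y, hpY, hYr, hYh⟩ := hY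
      refine ⟨Y.height, fun B hB hBr => ?_, Or.inr ⟨Y, hpY, by omega, rfl⟩⟩
      rcases Nat.lt_succ_iff_lt_or_eq.1 hBr with h1 | h1
      · exact (hle B hB h1).trans hYh
      · rw [hp B Y hB hpY (h1.trans hYr.symm)]
    · push Not at hY
      refine ⟨h, fun B hB hBr => ?_, hatt.imp_right ?_⟩
      · rcases Nat.lt_succ_iff_lt_or_eq.1 hBr with h1 | h1
        · exact hle B hB h1
        · exact (hY B hB h1).le
      · rintro ⟨B, hB, hBr, hBh⟩
        exact ⟨B, hB, by omega, hBh⟩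

/-- Two quorums share an honest replica. -/
theorem exists_mem_inter_of_quorums {f : ℕ} {F : Finset (Replica f)} (hF : F.card ≤ f)
    {S T : Set (Replica f)} (hS : 2 * f + 1 ≤ S.ncard) (hT : 2 * f + 1 ≤ T.ncard) :
    ∃ j, j ∉ F ∧ j ∈ S ∧ j ∈ T := by
  by_contra! hcon
  have hsub : S ∩ T ⊆ (F : Set (Replica f)) := fun j hj => by
    by_contra hjF
    exact hcon j hjF hj.1 hj.2
  -- The intersection has at least `2(2f + 1) - (3f + 1) = f + 1` elements, too many for `F`.
  have h1 := Set.ncard_le_ncard hsub (Set.toFinite _)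
  rw [Set.ncard_coe_finset] at h1
  have h2 := Set.ncard_union_add_ncard_inter S T
  have h3 := Set.ncard_le_card (S ∪ T)
  rw [Nat.card_eq_fintype_card, Fintype.card_fin] at h3
  omega

/-- If fewer than `f` of the leaders are faulty, then among any `n + 1` rounds after `R` there are
three consecutive ones with honest leaders, preceded by another one with an honest leader. -/
theorem exists_honest_leaders {f : ℕ} {F : Finset (Replica f)} (hF : F.card < f) (R : ℕ) :
    ∃ a b, R < a ∧ a < b ∧ b < R + (3 * f + 1) ∧ leader f a ∉ F ∧
      leader f b ∉ F ∧ leader f (b + 1) ∉ F ∧ leader f (b + 2) ∉ F := by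
  classical
  let W := Finset.Ico R (R + (3 * f + 1))
  let bad : ℕ → Finset ℕ := fun d => W.filter fun r => leader f (r + d) ∈ F
  have hbad : ∀ d, (bad d).card ≤ F.card := fun d => by
    refine Finset.card_le_card_of_injOn (fun r => leader f (r + d)) ?_ ?_
    · intro r hr
      exact (Finset.mem_filter.1 hr).2
    · intro r hr s hs hrs
      have hr' := Finset.mem_Ico.1 (Finset.mem_filter.1 hr).1
      have hs' := Finset.mem_Ico.1 (Finset.mem_filter.1 hs).1
      have h1 : (r + d) % (3 * f + 1) = (s + d) % (3 * f + 1) := congrArg Fin.val hrs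
      have h2 : r ≡ s [MOD 3 * f + 1] := Nat.ModEq.add_right_cancel' d h1
      rcases le_total r s with h | h
      · have := Nat.eq_zero_of_dvd_of_lt ((Nat.modEq_iff_dvd' h).1 h2) (by omega)
        omega
      · have := Nat.eq_zero_of_dvd_of_lt ((Nat.modEq_iff_dvd' h).1 h2.symm) (by omega)
        omega
  -- The window `W` meets each leader once, so each shift spoils at most `f - 1` rounds. At least
  -- `3f + 1 - 3(f - 1) = 4` rounds survive, and three after `R` is dropped to get `R < a`.
  let G := (W \ (bad 0 ∪ bad 1 ∪ bad 2)).erase R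
  have hG : 1 < G.card := by
    have h1 := Finset.pred_card_le_card_erase (a := R) (s := W \ (bad 0 ∪ bad 1 ∪ bad 2))
    have h2 := Finset.le_card_sdiff (bad 0 ∪ bad 1 ∪ bad 2) W
    have h3 := Finset.card_union_le (bad 0 ∪ bad 1) (bad 2)
    have h4 := Finset.card_union_le (bad 0) (bad 1)
    have h5 : W.card = 3 * f + 1 := by simp [W]
    have := hbad 0
    have := hbad 1
    have := hbad 2
    change 1 < ((W \ (bad 0 ∪ bad 1 ∪ bad 2)).erase R).card
    omega
  have hmem : ∀ r ∈ G, R < r ∧ r < R + (3 * f + 1) ∧ leader f r ∉ F ∧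
      leader f (r + 1) ∉ F ∧ leader f (r + 2) ∉ F := by
    intro r hr
    simp only [G, W, bad, Finset.mem_erase, Finset.mem_sdiff, Finset.mem_union,
      Finset.mem_filter, Finset.mem_Ico, add_zero, not_or, not_and] at hr
    obtain ⟨hne, hW, ⟨h0, h1⟩, h2⟩ := hr
    exact ⟨by omega, hW.2, h0 hW, h1 hW, h2 hW⟩
  obtain ⟨a, ha, b, hb, hab⟩ := Finset.one_lt_card.1 hG
  rcases Nat.lt_or_gt_of_ne hab with h | h
  · obtain ⟨a1, -, a3, -⟩ := hmem a ha
    obtain ⟨-, b2, b3⟩ := hmem b hb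
    exact ⟨a, b, a1, h, b2, a3, b3⟩
  · obtain ⟨a1, -, a3, -⟩ := hmem b hb
    obtain ⟨-, b2, b3⟩ := hmem a ha
    exact ⟨b, a, a1, h, b2, a3, b3⟩

namespace Execution

variable {f : ℕ} {Txn : Type*} {e : Execution f Txn}

/-! ### Views -/

theorem roundStart_succ (e : Execution f Txn) (r : ℕ) :
    e.roundStart (r + 1) = e.roundStart r + 2 * e.Δ := by
  simp only [roundStart]
  push_cast
  ring

theorem Valid.roundStart_strictMono (he : e.Valid) : StrictMono e.roundStart := by
  refine strictMono_nat_of_lt_succ fun r => ?_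
  have := he.delta_pos
  rw [roundStart_succ]
  linarith

theorem Valid.roundStart_add_le (he : e.Valid) {q r : ℕ} (h : q < r) :
    e.roundStart q + 2 * e.Δ ≤ e.roundStart r := by
  rw [← roundStart_succ]
  exact he.roundStart_strictMono.monotone h

theorem Valid.lt_of_inRound (he : e.Valid) {q r : ℕ} {t : ℝ} (h : e.InRound q t)
    (ht : t < e.roundStart r) : q < r :=
  he.roundStart_strictMono.lt_iff_lt.1 (h.2.1.trans_lt ht)

theorem Valid.exists_inRound (he : e.Valid) {t : ℝ} (ht : 0 ≤ t) : ∃ r, e.InRound r t := by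
  have h2 : 0 < 2 * e.Δ := by linarith [he.delta_pos]
  have h3 := Nat.floor_le (div_nonneg ht h2.le)
  have h4 := Nat.lt_floor_add_one (t / (2 * e.Δ))
  rw [le_div_iff₀ h2] at h3
  rw [div_lt_iff₀ h2] at h4
  refine ⟨⌊t / (2 * e.Δ)⌋₊ + 1, by omega, ?_, ?_⟩ <;> simp only [roundStart] <;> push_cast <;>
    nlinarith

theorem SeesVote.mono {i j : Replica f} {s t : ℝ} {A : Block f Txn} {μ : ℕ}
    (h : e.SeesVote i s j A μ) (hst : s ≤ t) : e.SeesVote i t j A μ := by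
  obtain ⟨m, hm, hc⟩ := h
  exact ⟨m, hm.trans (WithTop.coe_le_coe.2 hst), hc⟩

theorem Certified.imp {i j : Replica f} {s t : ℝ} {A : Block f Txn} (h : e.Certified i s A)
    (hv : ∀ k μ, e.SeesVote i s k A μ → e.SeesVote j t k A μ) : e.Certified j t A :=
  h.imp_right fun h => h.trans
    (Set.ncard_le_ncard (fun k ⟨μ, hk⟩ => ⟨μ, hv k μ hk⟩) (Set.toFinite _))

theorem CertifiedChain.mono {i : Replica f} {s t : ℝ} {B : Block f Txn}
    (h : e.CertifiedChain i s B) (hst : s ≤ t) : e.CertifiedChain i t B :=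
  fun A hA => (h A hA).imp fun _ _ hv => hv.mono hst

theorem certifiedChain_genesis (i : Replica f) (t : ℝ) :
    e.CertifiedChain i t Block.genesis :=
  fun _ hA => Or.inl hA

/-- What an honest replica has seen by time `t` is forwarded to all honest replicas. -/
theorem Valid.seesVote_forward (he : e.Valid) {i j k : Replica f} (hi : i ∉ e.faulty)
    (hj : j ∉ e.faulty) {t t' : ℝ} (ht : max e.GST t + e.Δ ≤ t') {A : Block f Txn} {μ : ℕ}
    (h : e.SeesVote i t k A μ) : e.SeesVote j t' k A μ := by
  obtain ⟨m, hm, hc⟩ := h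
  obtain ⟨s, hs, hst⟩ := WithTop.le_coe_iff.1 hm
  have h0 : 0 ≤ s := by
    have := he.recv_nonneg i m
    rw [hs] at this
    exact_mod_cast this
  obtain ⟨r, hr⟩ := he.exists_inRound h0
  refine ⟨m, ((he.honest i hi r hr.1).echo m s hr (WithTop.coe_lt_top s) hs j hj).trans
    (WithTop.coe_le_coe.2 (le_trans ?_ ht)), hc⟩
  have := max_le_max_left e.GST hst
  linarith

theorem Valid.certifiedChain_forward (he : e.Valid) {i j : Replica f} (hi : i ∉ e.faulty)
    (hj : j ∉ e.faulty) {t t' : ℝ} (ht : max e.GST t + e.Δ ≤ t') {B : Block f Txn}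
    (h : e.CertifiedChain i t B) : e.CertifiedChain j t' B :=
  fun A hA => (h A hA).imp fun _ _ => he.seesVote_forward hi hj ht

/-! ### Votes and quorums -/

/-- At least `2f + 1` replicas vote for `B` at some time. -/
def HasQuorum (e : Execution f Txn) (B : Block f Txn) : Prop :=
  2 * f + 1 ≤ {j | ∃ μ s, e.votes j B μ s}.ncard

/-- At least `2f + 1` replicas have voted for `B` before time `t`. -/
def HasQuorumBefore (e : Execution f Txn) (t : ℝ) (B : Block f Txn) : Prop :=
  2 * f + 1 ≤ {j | ∃ μ s, s < t ∧ e.votes j B μ s}.ncard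

theorem HasQuorumBefore.hasQuorum {t : ℝ} {B : Block f Txn} (h : e.HasQuorumBefore t B) :
    e.HasQuorum B :=
  le_trans h (Set.ncard_le_ncard (fun _ ⟨μ, s, _, hv⟩ => ⟨μ, s, hv⟩) (Set.toFinite _))

theorem Valid.hasQuorumBefore (he : e.Valid) {i : Replica f} {t : ℝ} {B : Block f Txn}
    (h : e.Certified i t B) : B = Block.genesis ∨ e.HasQuorumBefore t B := by
  refine h.imp_right fun h => le_trans h (Set.ncard_le_ncard ?_ (Set.toFinite _))
  rintro j ⟨μ, m, hm, hc⟩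
  obtain ⟨s, hs, hst⟩ := WithTop.le_coe_iff.1 hm
  obtain ⟨s', hs', hv⟩ := he.auth_vote i m s hs j B μ hc
  exact ⟨μ, s', hs'.trans_le hst, hv⟩

theorem Valid.voteRule (he : e.Valid) {i : Replica f} (hi : i ∉ e.faulty) {B : Block f Txn}
    {μ : ℕ} {t : ℝ} (h : e.votes i B μ t) : e.VoteRule i B μ t := by
  have h1 : 1 ≤ B.round :=
    Nat.one_le_iff_ne_zero.2 fun h0 => he.honest_zero i hi B μ t h0 h
  exact ((he.honest i hi B.round h1).vote_sound B μ t rfl h).1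

/-- Each of the two proposals is the first of its round to arrive during the round, so they arrive
at the same instant, and only one message is received at a time. -/
theorem Valid.vote_unique (he : e.Valid) {i : Replica f} (hi : i ∉ e.faulty)
    {B B' : Block f Txn} {μ μ' : ℕ} {t t' : ℝ} (h : e.votes i B μ t) (h' : e.votes i B' μ' t')
    (hr : B.round = B'.round) : B = B' := by
  obtain ⟨⟨-, hs, -⟩, hrec, hfirst, -⟩ := he.voteRule hi h
  obtain ⟨⟨-, hs', -⟩, hrec', hfirst', -⟩ := he.voteRule hi h'
  have h1 := hfirst B' hr.symm (by rw [hrec', hr]; exact WithTop.coe_le_coe.2 hs')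
  have h2 := hfirst' B hr (by rw [hrec, ← hr]; exact WithTop.coe_le_coe.2 hs)
  have h3 : e.recvTime i (Msg.propose B) = e.recvTime i (Msg.propose B') :=
    le_antisymm (by rwa [hrec]) (by rwa [hrec'])
  have h4 := he.recv_inj i _ _ h3 (by rw [hrec]; exact WithTop.coe_ne_top)
  injection h4

/-- A replica that receives a block sees a certified chain ending in its parent. -/
theorem Valid.certifiedChain_parent (he : e.Valid) {i : Replica f} {p : Block f Txn}
    {qc : Replica f → Option ℕ} {r : ℕ} {x : Txn} {t : ℝ}
    (h : e.recvTime i (Msg.propose (Block.mk p qc r x)) = (t : WithTop ℝ)) :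
    e.CertifiedChain i t p := by
  intro A hA
  have hw : (Block.mk p qc r x).WellFormed :=
    he.recv_wellFormed i (Msg.propose (Block.mk p qc r x)) (by rw [h]; exact WithTop.coe_ne_top)
  refine (hw.quorum hA).imp_right fun hq => hq.trans (Set.ncard_le_ncard ?_ (Set.toFinite _))
  rintro j ⟨μ, hμ⟩
  exact ⟨μ, _, h.le, Or.inr hμ⟩

/-- A voter has received the proposal, and the nested strong-QCs certify everything below it. The
voter therefore knows a certified chain only one block lower than the block it votes for. -/
theorem Valid.exists_parent_of_vote (he : e.Valid) {i : Replica f} (hi : i ∉ e.faulty)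
    {B : Block f Txn} {μ : ℕ} {t : ℝ} (h : e.votes i B μ t) :
    ∃ P, B.Extends P ∧ B.height = P.height + 1 ∧ e.CertifiedChain i t P ∧
      ∀ A, B.Extends A → A = B ∨ P.Extends A := by
  obtain ⟨hin, hrec, -⟩ := he.voteRule hi h
  cases B with
  | genesis => exact absurd rfl (Block.ne_genesis_of_round_pos hin.1)
  | mk p qc r x =>
    exact ⟨p, Or.inr p.extends_refl, rfl, he.certifiedChain_parent hrec, fun A hA => hA⟩

theorem Valid.hasQuorum_unique (he : e.Valid) (hc : e.faulty.card ≤ f) {A B : Block f Txn}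
    (hA : e.HasQuorum A) (hB : e.HasQuorum B) (hr : A.round = B.round) : A = B := by
  obtain ⟨j, hj, ⟨_, _, h1⟩, ⟨_, _, h2⟩⟩ := exists_mem_inter_of_quorums hc hA hB
  exact he.vote_unique hj h1 h2 hr

theorem exists_honest_vote (hc : e.faulty.card ≤ f) {B : Block f Txn}
    (hB : e.HasQuorum B) : ∃ i, i ∉ e.faulty ∧ ∃ μ t, e.votes i B μ t := by
  obtain ⟨j, hj, h, -⟩ := exists_mem_inter_of_quorums hc hB hB
  exact ⟨j, hj, h⟩

theorem Valid.round_pos (he : e.Valid) (hc : e.faulty.card ≤ f) {B : Block f Txn}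
    (hB : e.HasQuorum B) : 1 ≤ B.round := by
  obtain ⟨j, hj, μ, t, h⟩ := exists_honest_vote hc hB
  exact (he.voteRule hj h).1.1

theorem Valid.round_lt (he : e.Valid) (hc : e.faulty.card ≤ f) {B : Block f Txn} {r : ℕ}
    (hB : e.HasQuorumBefore (e.roundStart r) B) : B.round < r := by
  obtain ⟨j, hj, ⟨μ, s, hs, hv⟩, -⟩ := exists_mem_inter_of_quorums hc hB hB
  exact he.lt_of_inRound (he.voteRule hj hv).1 hs

/-- If `X` and `Y` both gather a quorum, then some honest replica votes for both, and knows no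
certified chain as high as `Y` when it votes for `Y`. -/
theorem Valid.exists_first_voter (he : e.Valid) (hc : e.faulty.card ≤ f) {X Y : Block f Txn}
    (hX : e.HasQuorum X) (hY : e.HasQuorum Y) :
    ∃ i, i ∉ e.faulty ∧ (∃ μ s, e.votes i X μ s) ∧ ∃ ν t, e.votes i Y ν t ∧
      ∀ C, e.CertifiedChain i t C → C.height < Y.height := by
  let S : Set (Replica f) := {i | i ∉ e.faulty ∧ (∃ μ s, e.votes i X μ s) ∧ ∃ ν t, e.votes i Y ν t}
  have hne : S.Nonempty := by
    obtain ⟨j, hj, h1, h2⟩ := exists_mem_inter_of_quorums hc hX hY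
    exact ⟨j, hj, h1, h2⟩
  -- Honest replicas vote at the instant they receive a proposal, so minimal receipt time means
  -- first to vote for `Y` among the honest voters for both blocks.
  obtain ⟨i, ⟨hi, hiX, ν, t, hv⟩, hmin⟩ :=
    Set.exists_min_image S (fun i => e.recvTime i (Msg.propose Y)) (Set.toFinite _) hne
  refine ⟨i, hi, hiX, ν, t, hv, fun C hC => ?_⟩
  obtain ⟨hin, hrec, -, ⟨D, ⟨hD, hmax⟩, hext⟩, -⟩ := he.voteRule hi hv
  refine (hmax C hC).trans_lt ?_
  -- The voting rule allows the longest chain to end in `Y` itself. But then a quorum for `Y` voted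
  -- earlier, and it shares with the quorum of `X` an honest replica that precedes the first one.
  by_contra! hle
  have hDY := hext.eq_of_height_le hle
  subst hDY
  rcases he.hasQuorumBefore (hD D D.extends_refl) with h | h
  · exact Block.ne_genesis_of_round_pos hin.1 h
  · obtain ⟨j, hj, hjX, ν', s, hs, hvs⟩ := exists_mem_inter_of_quorums hc hX h
    have := hmin j ⟨hj, hjX, ν', s, hvs⟩
    simp only [hrec, (he.voteRule hj hvs).2.1, WithTop.coe_le_coe] at this
    linarith

/-! ### Safety -/

/-- The common voter knew the parent of `X` on a certified chain when it voted for `X`, hence also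
when it voted for `Y`; that chain is lower than `Y`. -/
theorem Valid.height_le_of_round_lt (he : e.Valid) (hc : e.faulty.card ≤ f)
    {X Y : Block f Txn} (hX : e.HasQuorum X) (hY : e.HasQuorum Y) (h : X.round < Y.round) :
    X.height ≤ Y.height := by
  obtain ⟨i, hi, ⟨μ, s, hvX⟩, ν, t, hvY, hlt⟩ := he.exists_first_voter hc hX hY
  obtain ⟨P, -, hPh, hP, -⟩ := he.exists_parent_of_vote hi hvX
  have hst : s ≤ t := by
    have h1 := (he.voteRule hi hvX).1.2.2
    have h2 := (he.voteRule hi hvY).1.2.1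
    have h3 := he.roundStart_strictMono.monotone h
    exact (h1.trans_le (h3.trans h2)).le
  have := hlt P (hP.mono hst)
  omega

/-- A block with a quorum that is as high as the middle one of three adjacent blocks with quorums
and consecutive rounds is equal to it. -/
theorem Valid.eq_of_height_eq (he : e.Valid) (hc : e.faulty.card ≤ f) {P B C D : Block f Txn}
    (hPB : P.height + 1 = B.height) (hBC : B.height + 1 = C.height)
    (hr : B.round = P.round + 1) (hr' : C.round = B.round + 1)
    (hP : P = Block.genesis ∨ e.HasQuorum P) (hB : e.HasQuorum B) (hC : e.HasQuorum C)
    (hD : e.HasQuorum D) (h : D.height = B.height) : D = B := by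
  -- As rounds are consecutive, a round other than that of `B` is at most that of `P` or at least
  -- that of `C`. Monotonicity of heights then makes `D` too low or too high.
  rcases lt_trichotomy D.round B.round with h1 | h1 | h1
  · have hD1 := he.round_pos hc hD
    rcases hP with rfl | hP
    · have : (Block.genesis : Block f Txn).round = 0 := rfl
      omega
    · rcases Nat.lt_or_ge D.round P.round with h2 | h2
      · have := he.height_le_of_round_lt hc hD hP h2
        omega
      · have := he.hasQuorum_unique hc hD hP (by omega)
        subst this
        omega
  · exact he.hasQuorum_unique hc hD hB h1
  · rcases Nat.lt_or_ge C.round D.round with h2 | h2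
    · have := he.height_le_of_round_lt hc hC hD h2
      omega
    · have := he.hasQuorum_unique hc hD hC (by omega)
      subst this
      omega

theorem height_of_isParentOf {P B : Block f Txn} (h : P.IsParentOf B) :
    P.height + 1 = B.height := by
  cases B with
  | genesis => exact h.elim
  | mk p => cases h; rfl

/-- A higher block with a quorum extends the middle one of three adjacent blocks with quorums and
consecutive rounds. -/
theorem Valid.extends_of_height_le (he : e.Valid) (hc : e.faulty.card ≤ f)
    {P B C D : Block f Txn} (hPB : P.IsParentOf B) (hBC : B.IsParentOf C)
    (hr : B.round = P.round + 1) (hr' : C.round = B.round + 1)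
    (hP : P = Block.genesis ∨ e.HasQuorum P) (hB : e.HasQuorum B) (hC : e.HasQuorum C)
    (hD : e.HasQuorum D) (h : B.height ≤ D.height) : D.Extends B := by
  obtain ⟨A, hDA, hA⟩ := D.exists_ancestor h
  have h1 := height_of_isParentOf hPB
  -- An honest voter for `D` has seen all proper ancestors of `D` certified.
  have hAq : e.HasQuorum A := by
    obtain ⟨i, hi, μ, t, hv⟩ := exists_honest_vote hc hD
    obtain ⟨Q, -, -, hQ, hanc⟩ := he.exists_parent_of_vote hi hv
    rcases hanc A hDA with rfl | hQA
    · exact hD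
    · rcases he.hasQuorumBefore (hQ A hQA) with rfl | hq
      · simp only [Block.height] at hA
        omega
      · exact hq.hasQuorum
  have := he.eq_of_height_eq hc h1 (height_of_isParentOf hBC) hr hr' hP hB hC hAq hA
  rwa [← this]

/-! ### Proposals that reach all honest replicas -/

/-- `B` is the only proposal of round `q`; it obeys the proposing rule and is multicast at the start
of the round. -/
structure IsSoleProposal (e : Execution f Txn) (q : ℕ) (B : Block f Txn) : Prop where
  rule : e.ProposeRule (leader f q) q B
  delivered : e.Delivered (Msg.propose B) (e.roundStart q)
  unique : ∀ B' t, B'.round = q → (e.proposes B' t ↔ B' = B ∧ t = e.roundStart q)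

theorem IsSoleProposal.round_eq {q : ℕ} {B : Block f Txn} (h : e.IsSoleProposal q B) :
    B.round = q := by
  obtain ⟨P, qc, x, rfl, -⟩ := h.rule
  rfl

theorem Valid.exists_isSoleProposal (he : e.Valid) {q : ℕ} (hq : 1 ≤ q)
    (hl : leader f q ∉ e.faulty) : ∃ B, e.IsSoleProposal q B := by
  obtain ⟨B, h1, h2, h3⟩ := (he.honest _ hl q hq).propose rfl (WithTop.coe_lt_top _)
  exact ⟨B, h1, h2, h3⟩

/-- A vote proves that a proposal was made. A crashing leader proposes either to everyone or not at
all, so this proposal is the only one and reaches all honest replicas. -/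
theorem Valid.isSoleProposal_of_vote (he : e.Valid) {τ : WithTop ℝ} {B : Block f Txn}
    (hF : e.FollowsRound (leader f B.round) B.round τ) {i : Replica f} (hi : i ∉ e.faulty)
    {μ : ℕ} {t : ℝ} (h : e.votes i B μ t) : e.IsSoleProposal B.round B := by
  obtain ⟨s, -, hs⟩ := he.auth_propose i B t (he.voteRule hi h).2.1
  rcases lt_or_ge (e.roundStart B.round : WithTop ℝ) τ with h1 | h1
  · obtain ⟨B', hB', hd, hu⟩ := hF.propose rfl h1
    obtain ⟨rfl, -⟩ := (hu B s rfl).1 hs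
    exact ⟨hB', hd, hu⟩
  · exact absurd hs (hF.no_propose rfl h1 B s rfl)

theorem Valid.exists_recvTime (he : e.Valid) {q : ℕ} {B : Block f Txn}
    (hB : e.IsSoleProposal q B) (hG : e.GST ≤ e.roundStart q) {i : Replica f}
    (hi : i ∉ e.faulty) : ∃ t : ℝ, e.recvTime i (Msg.propose B) = (t : WithTop ℝ) ∧
      e.roundStart q < t ∧ t ≤ e.roundStart q + e.Δ := by
  have h := hB.delivered i hi
  rw [max_eq_right hG] at h
  obtain ⟨t, ht, hle⟩ := WithTop.le_coe_iff.1 h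
  obtain ⟨s, hs, hp⟩ := he.auth_propose i B t ht
  obtain ⟨-, rfl⟩ := (hB.unique B s hB.round_eq).1 hp
  exact ⟨t, ht, hs, hle⟩

/-- The maximum exists because an honest replica votes for at most one block per round, which bounds
the heights it has voted for by time `t`. -/
theorem Valid.exists_isMarker (he : e.Valid) {i : Replica f} (hi : i ∉ e.faulty) (t : ℝ)
    (B : Block f Txn) {q : ℕ} (hq : t ≤ e.roundStart q) : ∃ μ, e.IsMarker i t B μ := by
  obtain ⟨M, hM, -⟩ := exists_max_height (p := fun A => ∃ μ s, e.votes i A μ s)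
    (fun A A' ⟨_, _, h⟩ ⟨_, _, h'⟩ hr => he.vote_unique hi h h' hr) q
  have hb : BddAbove (insert 0 {h | ∃ B' μ' s, s < t ∧ e.votes i B' μ' s ∧ B'.Conflicts B ∧
      h = B'.height}) := by
    refine ⟨M, ?_⟩
    rintro h (rfl | ⟨A, μ, s, hs, hv, -, rfl⟩)
    · exact Nat.zero_le _
    · exact hM A ⟨μ, s, hv⟩ (he.lt_of_inRound (he.voteRule hi hv).1 (hs.trans_le hq))
  exact ⟨_, Nat.sSup_mem ⟨0, Or.inl rfl⟩ hb, fun _ h => le_csSup hb h⟩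

theorem Valid.vote_of_longestCertified (he : e.Valid) {q : ℕ} (hq : 1 ≤ q) {B C : Block f Txn}
    (hB : e.IsSoleProposal q B) {i : Replica f} (hi : i ∉ e.faulty) {t : ℝ}
    (ht : e.recvTime i (Msg.propose B) = (t : WithTop ℝ)) (hqt : e.roundStart q < t)
    (htq : t ≤ e.roundStart q + e.Δ) (hC : e.LongestCertified i t C) (hBC : B.Extends C) :
    ∃ μ, e.votes i B μ t ∧ e.Delivered (Msg.vote i B μ) t := by
  have hlt : t < e.roundStart (q + 1) := by
    rw [roundStart_succ]
    linarith [he.delta_pos]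
  obtain ⟨μ, hμ⟩ := he.exists_isMarker hi t B hlt.le
  refine ⟨μ, (he.honest i hi q hq).vote B μ t hB.round_eq ⟨?_, ht, ?_, ⟨C, hC, hBC⟩, hμ⟩
    (WithTop.coe_lt_top _)⟩
  · rw [hB.round_eq]
    exact ⟨hq, hqt.le, hlt⟩
  · intro B' hr _
    rcases eq_or_ne (e.recvTime i (Msg.propose B')) ⊤ with h | h
    · rw [h]
      exact le_top
    · obtain ⟨t', ht'⟩ := WithTop.ne_top_iff_exists.1 h
      obtain ⟨s, -, hs⟩ := he.auth_propose i B' t' ht'.symm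
      obtain ⟨rfl, -⟩ := (hB.unique B' s (hr.trans hB.round_eq)).1 hs
      exact ht.ge

/-- By time `t` all honest replicas have seen the votes of all honest replicas for `B`. -/
def SeenByHonest (e : Execution f Txn) (t : ℝ) (B : Block f Txn) : Prop :=
  ∀ i, i ∉ e.faulty → ∀ j, j ∉ e.faulty → ∃ μ, e.SeesVote i t j B μ

theorem SeenByHonest.mono {s t : ℝ} {B : Block f Txn} (h : e.SeenByHonest s B) (hst : s ≤ t) :
    e.SeenByHonest t B := fun i hi j hj =>
  (h i hi j hj).imp fun _ h => h.mono hst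

theorem ncard_honest_le (e : Execution f Txn) {S : Set (Replica f)}
    (h : ∀ j, j ∉ e.faulty → j ∈ S) : 3 * f + 1 - e.faulty.card ≤ S.ncard := by
  have h1 : ((e.faultyᶜ : Finset (Replica f)) : Set (Replica f)) ⊆ S := fun j hj =>
    h j (by simpa using hj)
  have h2 := Set.ncard_le_ncard h1 (Set.toFinite _)
  rwa [Set.ncard_coe_finset, Finset.card_compl, Fintype.card_fin] at h2

/-- Direct votes endorse whatever their marker, hence the arbitrary `k`. -/
theorem SeenByHonest.le_endorsers {t : ℝ} {B : Block f Txn} (h : e.SeenByHonest t B)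
    {i : Replica f} (hi : i ∉ e.faulty) (k : ℕ) :
    3 * f + 1 - e.faulty.card ≤ (e.endorsers i t k B).ncard :=
  e.ncard_honest_le fun j hj => Or.inr (by
    obtain ⟨μ, hμ⟩ := h i hi j hj
    exact ⟨B, μ, hμ, Or.inl rfl⟩)

theorem SeenByHonest.certified {t : ℝ} {B : Block f Txn} (h : e.SeenByHonest t B)
    (hc : e.faulty.card ≤ f) {i : Replica f} (hi : i ∉ e.faulty) : e.Certified i t B := by
  have := e.ncard_honest_le (S := {j | ∃ μ, e.SeesVote i t j B μ}) (h i hi)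
  exact Or.inr (by omega)

/-- If every honest replica finds that the sole proposal extends one of its longest certified
chains, then by the end of the round all honest replicas have seen all honest votes for it. -/
theorem Valid.seenByHonest (he : e.Valid) {q : ℕ} (hq : 1 ≤ q) (hG : e.GST ≤ e.roundStart q)
    {B : Block f Txn} (hB : e.IsSoleProposal q B)
    (hl : ∀ i, i ∉ e.faulty → ∀ t : ℝ, e.recvTime i (Msg.propose B) = (t : WithTop ℝ) →
      t ≤ e.roundStart q + e.Δ → ∃ C, e.LongestCertified i t C ∧ B.Extends C) :
    e.SeenByHonest (e.roundStart (q + 1)) B := by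
  intro i hi j hj
  obtain ⟨t, ht, h1, h2⟩ := he.exists_recvTime hB hG hj
  obtain ⟨C, hC, hBC⟩ := hl j hj t ht h2
  obtain ⟨μ, -, hd⟩ := he.vote_of_longestCertified hq hB hj ht h1 h2 hC hBC
  -- One `Δ` for the proposal and one for the vote fill the round exactly.
  refine ⟨μ, _, (hd i hi).trans (WithTop.coe_le_coe.2 ?_), Or.inl rfl⟩
  rw [max_eq_right (hG.trans h1.le), roundStart_succ]
  linarith

/-! ### Progress in a period of synchrony -/

/-- At the start of round `r` every honest replica knows a certified chain of height `h`. -/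
def KnownHeight (e : Execution f Txn) (r h : ℕ) : Prop :=
  ∀ i, i ∉ e.faulty → ∃ C, e.CertifiedChain i (e.roundStart r) C ∧ h ≤ C.height

/-- The blocks of the rounds before `r` that ever gather a quorum have height at most `h`. -/
def QuorumHeightLE (e : Execution f Txn) (r h : ℕ) : Prop :=
  ∀ B, e.HasQuorum B → B.round < r → B.height ≤ h

/-- At the start of round `r` the honest replicas know certified chains of the largest height that
a block of an earlier round can attain. -/
def Settled (e : Execution f Txn) (r : ℕ) : Prop :=
  ∃ h, e.KnownHeight r h ∧ e.QuorumHeightLE r h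

theorem KnownHeight.succ {r h : ℕ} (hk : e.KnownHeight r h) (he : e.Valid) :
    e.KnownHeight (r + 1) h := fun i hi => by
  obtain ⟨C, hC, hh⟩ := hk i hi
  exact ⟨C, hC.mono (he.roundStart_strictMono.monotone (Nat.le_succ r)), hh⟩

theorem Valid.knownHeight_of_chain (he : e.Valid) {i : Replica f} (hi : i ∉ e.faulty) {t : ℝ}
    {C : Block f Txn} (hC : e.CertifiedChain i t C) {r h : ℕ} (hh : h ≤ C.height)
    (ht : max e.GST t + e.Δ ≤ e.roundStart r) : e.KnownHeight r h := fun _ hj =>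
  ⟨C, he.certifiedChain_forward hi hj ht hC, hh⟩

theorem IsSoleProposal.exists_parent {q : ℕ} {B : Block f Txn} (hB : e.IsSoleProposal q B)
    (he : e.Valid) (hc : e.faulty.card ≤ f) :
    ∃ P, P.IsParentOf B ∧ B.Extends P ∧ e.LongestCertified (leader f q) (e.roundStart q) P ∧
      (P = Block.genesis ∨ e.HasQuorum P ∧ P.round < q) ∧
      ∀ i (t : ℝ), e.recvTime i (Msg.propose B) = (t : WithTop ℝ) → e.CertifiedChain i t P := by
  obtain ⟨P, qc, x, rfl, -, hP, -⟩ := hB.rule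
  refine ⟨P, rfl, Or.inr P.extends_refl, hP, ?_, fun i t h => he.certifiedChain_parent h⟩
  exact (he.hasQuorumBefore (hP.1 P P.extends_refl)).imp_right fun h =>
    ⟨h.hasQuorum, he.round_lt hc h⟩

theorem SeenByHonest.knownHeight {q : ℕ} {B : Block f Txn}
    (h : e.SeenByHonest (e.roundStart (q + 1)) B) (he : e.Valid) (hc : e.faulty.card ≤ f)
    (hG : e.GST ≤ e.roundStart q) (hB : e.IsSoleProposal q B) :
    e.KnownHeight (q + 1) B.height := fun i hi => by
  refine ⟨B, ?_, le_rfl⟩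
  obtain ⟨t, ht, h1, h2⟩ := he.exists_recvTime hB hG hi
  have h3 : t ≤ e.roundStart (q + 1) := by
    rw [roundStart_succ]
    linarith [he.delta_pos]
  have hcert := h.certified hc hi
  obtain ⟨P, qc, x, rfl, -⟩ := hB.rule
  rintro A (rfl | hA)
  · exact hcert
  · exact (he.certifiedChain_parent ht).mono h3 A hA

/-- A sole proposal makes the honest replicas know a certified chain of its height, its own one or
one that kept a replica from voting. -/
theorem Valid.knownHeight_of_isSoleProposal (he : e.Valid) (hc : e.faulty.card ≤ f) {q : ℕ}
    (hq : 1 ≤ q) (hG : e.GST ≤ e.roundStart q) {B : Block f Txn} (hB : e.IsSoleProposal q B) :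
    e.KnownHeight (q + 1) B.height := by
  obtain ⟨P, hPB, hBP, -, -, hPc⟩ := hB.exists_parent he hc
  have hPh := height_of_isParentOf hPB
  -- A rival chain as high as `B`, known to an honest replica by mid-round, is forwarded to all by
  -- the end of the round. Without such a rival, the parent of `B` ends a longest chain for every
  -- voter.
  by_cases hk : ∃ i, i ∉ e.faulty ∧ ∃ t : ℝ, t ≤ e.roundStart q + e.Δ ∧
      ∃ C, e.CertifiedChain i t C ∧ B.height ≤ C.height
  · obtain ⟨i, hi, t, ht, C, hC, hh⟩ := hk
    refine he.knownHeight_of_chain hi hC hh ?_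
    have := max_le (hG.trans (by linarith [he.delta_pos])) ht
    rw [roundStart_succ]
    linarith
  · push Not at hk
    refine SeenByHonest.knownHeight (he.seenByHonest hq hG hB fun i hi t ht htq => ?_) he hc hG hB
    refine ⟨P, ⟨hPc i t ht, fun C hC => ?_⟩, hBP⟩
    have := hk i hi t htq C hC
    omega

/-- A sole proposal higher than all earlier blocks with quorums gets the votes of all honest
replicas. -/
theorem Valid.seenByHonest_of_quorumHeightLE (he : e.Valid) (hc : e.faulty.card ≤ f) {q h : ℕ}
    (hq : 1 ≤ q) (hG : e.GST ≤ e.roundStart q) {B : Block f Txn} (hB : e.IsSoleProposal q B)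
    (hU : e.QuorumHeightLE q h) (hh : h < B.height) :
    e.SeenByHonest (e.roundStart (q + 1)) B := by
  obtain ⟨P, hPB, hBP, -, -, hPc⟩ := hB.exists_parent he hc
  have hPh := height_of_isParentOf hPB
  refine he.seenByHonest hq hG hB fun i hi t ht htq => ?_
  -- Earlier rounds offer no such height, and round `q` has no other proposal. The case `C = B` is
  -- real: votes for `B` may arrive before the proposal does.
  have key : ∀ C, e.CertifiedChain i t C → B.height ≤ C.height → C = B := by
    intro C hC hle
    rcases he.hasQuorumBefore (hC C C.extends_refl) with rfl | hCq
    · simp only [Block.height] at hle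
      omega
    · have hlt : t ≤ e.roundStart (q + 1) := by
        rw [roundStart_succ]
        linarith [he.delta_pos]
      obtain ⟨j, hj, ⟨μ, s, hs, hv⟩, -⟩ := exists_mem_inter_of_quorums hc hCq hCq
      have hr := he.lt_of_inRound (he.voteRule hj hv).1 (hs.trans_le hlt)
      rcases Nat.lt_succ_iff_lt_or_eq.1 hr with h1 | h1
      · have := hU C hCq.hasQuorum h1
        omega
      · obtain ⟨s', -, hs'⟩ := he.auth_propose j C s (he.voteRule hj hv).2.1
        exact ((hB.unique C s' h1).1 hs').1
  by_cases hex : ∃ C, e.CertifiedChain i t C ∧ B.height ≤ C.height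
  · obtain ⟨C, hC, hle⟩ := hex
    obtain rfl := key C hC hle
    refine ⟨C, ⟨hC, fun C' hC' => ?_⟩, C.extends_refl⟩
    by_contra! hlt
    rw [key C' hC' hlt.le] at hlt
    exact lt_irrefl _ hlt
  · push Not at hex
    refine ⟨P, ⟨hPc i t ht, fun C hC => ?_⟩, hBP⟩
    have := hex C hC
    omega

/-- The rounds from `R` on, up to round `N - 1`, start after GST, and their leaders make at most one
proposal each, at the start of the round, obeying the proposing rule. -/
structure CrashPeriod (e : Execution f Txn) (R N : ℕ) : Prop where
  valid : e.Valid
  faulty_card : e.faulty.card ≤ f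
  one_le : 1 ≤ R
  gst_le : e.GST ≤ e.roundStart R
  leader_follows : ∀ r, R ≤ r → r < N → ∃ τ, e.FollowsRound (leader f r) r τ

namespace CrashPeriod

variable {R N : ℕ}

theorem gst_le_roundStart (w : e.CrashPeriod R N) {q : ℕ} (hq : R ≤ q) :
    e.GST ≤ e.roundStart q :=
  w.gst_le.trans (w.valid.roundStart_strictMono.monotone hq)

theorem isSoleProposal (w : e.CrashPeriod R N) {B : Block f Txn} (hR : R ≤ B.round)
    (hN : B.round < N) (hB : e.HasQuorum B) : e.IsSoleProposal B.round B := by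
  obtain ⟨i, hi, μ, t, hv⟩ := exists_honest_vote w.faulty_card hB
  obtain ⟨τ, hτ⟩ := w.leader_follows _ hR hN
  exact w.valid.isSoleProposal_of_vote hτ hi hv

/-- After the first round of the period the honest replicas lag behind by at most one block. -/
theorem exists_knownHeight_pred (w : e.CrashPeriod R N) {r : ℕ} (hr : R < r) (hN : r ≤ N) :
    ∃ h, e.QuorumHeightLE r h ∧ e.KnownHeight r (h - 1) := by
  have he := w.valid
  obtain ⟨h, hU, hatt⟩ := exists_max_height (p := e.HasQuorum)
    (fun A B hA hB => he.hasQuorum_unique w.faulty_card hA hB) r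
  refine ⟨h, hU, ?_⟩
  rcases hatt with rfl | ⟨Y, hY, hYr, rfl⟩
  · exact fun i _ => ⟨Block.genesis, certifiedChain_genesis i _, Nat.zero_le _⟩
  · obtain ⟨i, hi, μ, t, hv⟩ := exists_honest_vote w.faulty_card hY
    obtain ⟨P, -, hPh, hP, -⟩ := he.exists_parent_of_vote hi hv
    refine he.knownHeight_of_chain hi hP (by omega) ?_
    obtain ⟨hin, hrec, -⟩ := he.voteRule hi hv
    have hΔ := he.delta_pos
    -- The voter's view at its vote includes the parent of `Y`. A vote cast before the period is
    -- only known to be forwarded by `Δ` after the start of round `R`, hence the need for `R < r`; a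
    -- vote of the period is cast in the first half of its round.
    rcases Nat.lt_or_ge Y.round R with hy | hy
    · have h1 := he.roundStart_strictMono.monotone (Nat.succ_le_of_lt hy)
      have h2 := max_le w.gst_le (hin.2.2.le.trans h1)
      have h3 := he.roundStart_add_le hr
      linarith
    · have hG := w.gst_le_roundStart hy
      obtain ⟨t', ht', -, hle⟩ :=
        he.exists_recvTime (w.isSoleProposal hy (hYr.trans_le hN) hY) hG hi
      obtain rfl : t = t' := by
        rw [hrec] at ht'
        exact WithTop.coe_injective ht'
      have h2 := max_le (hG.trans (by linarith)) hle
      have h3 := he.roundStart_add_le hYr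
      linarith

/-- The leader knows a chain of height at least `h - 1`, so its block reaches height `h` at least.
After the round all honest replicas know that height, and no other block of round `r` can gather a
quorum. -/
theorem settled_of_honest_leader (w : e.CrashPeriod R N) {r : ℕ} (hr : R < r) (hN : r ≤ N)
    (hl : leader f r ∉ e.faulty) : e.Settled (r + 1) := by
  have he := w.valid
  have h1 : 1 ≤ r := w.one_le.trans hr.le
  obtain ⟨h, hU, hS⟩ := w.exists_knownHeight_pred hr hN
  obtain ⟨B, hB⟩ := he.exists_isSoleProposal h1 hl
  obtain ⟨P, hPB, -, hP, -⟩ := hB.exists_parent he w.faulty_card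
  have hPh := height_of_isParentOf hPB
  obtain ⟨C, hC, hCh⟩ := hS _ hl
  have hCP := hP.2 C hC
  refine ⟨B.height, he.knownHeight_of_isSoleProposal w.faulty_card h1
    (w.gst_le_roundStart hr.le) hB, fun Y hY hYr => ?_⟩
  rcases Nat.lt_succ_iff_lt_or_eq.1 hYr with hlt | heq
  · have := hU Y hY hlt
    omega
  · obtain ⟨i, hi, μ, t, hv⟩ := exists_honest_vote w.faulty_card hY
    obtain ⟨s, -, hs⟩ := he.auth_propose i Y t (he.voteRule hi hv).2.1
    rw [((hB.unique Y s heq).1 hs).1]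

/-- In a settled round a block that gathers a quorum is voted for by all honest replicas, and is
one block higher than all earlier ones. -/
theorem seenByHonest_of_hasQuorum (w : e.CrashPeriod R N) {h : ℕ} {Y : Block f Txn}
    (hR : R ≤ Y.round) (hN : Y.round < N) (hS : e.KnownHeight Y.round h)
    (hU : e.QuorumHeightLE Y.round h) (hY : e.HasQuorum Y) :
    e.SeenByHonest (e.roundStart (Y.round + 1)) Y ∧ h < Y.height := by
  have he := w.valid
  have hlt : h < Y.height := by
    obtain ⟨i, hi, -, ν, t, hv, hmax⟩ := he.exists_first_voter w.faulty_card hY hY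
    obtain ⟨C, hC, hCh⟩ := hS i hi
    exact hCh.trans_lt (hmax C (hC.mono (he.voteRule hi hv).1.2.1))
  exact ⟨he.seenByHonest_of_quorumHeightLE w.faulty_card (w.one_le.trans hR)
    (w.gst_le_roundStart hR) (w.isSoleProposal hR hN hY) hU hlt, hlt⟩

/-- If a block of the round gathers a quorum, its height becomes the new bound and all honest
replicas know it; if none does, the old bound survives. -/
theorem settled_succ (w : e.CrashPeriod R N) {q : ℕ} (hR : R ≤ q) (hN : q < N)
    (hs : e.Settled q) : e.Settled (q + 1) := by
  have he := w.valid
  obtain ⟨h, hS, hU⟩ := hs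
  by_cases hY : ∃ Y, e.HasQuorum Y ∧ Y.round = q
  · obtain ⟨Y, hY, rfl⟩ := hY
    obtain ⟨hseen, hlt⟩ := w.seenByHonest_of_hasQuorum hR hN hS hU hY
    refine ⟨Y.height, hseen.knownHeight he w.faulty_card (w.gst_le_roundStart hR)
      (w.isSoleProposal hR hN hY), fun B hB hBr => ?_⟩
    rcases Nat.lt_succ_iff_lt_or_eq.1 hBr with h1 | h1
    · exact (hU B hB h1).trans hlt.le
    · rw [he.hasQuorum_unique w.faulty_card hB hY h1]
  · push Not at hY
    refine ⟨h, hS.succ he, fun B hB hBr => hU B hB ?_⟩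
    have := hY B hB
    omega

theorem settled_of_le (w : e.CrashPeriod R N) {q r : ℕ} (hR : R ≤ q) (hqr : q ≤ r) (hN : r ≤ N)
    (hs : e.Settled q) : e.Settled r := by
  induction r, hqr using Nat.le_induction with
  | base => exact hs
  | succ r hqr ih => exact w.settled_succ (hR.trans hqr) hN (ih (Nat.le_of_succ_le hN))

/-- In a settled round an honest leader proposes a block that gets all honest votes, and whose
parent has the largest height that a block of an earlier round can attain. -/
theorem exists_block_of_honest_leader (w : e.CrashPeriod R N) {q h : ℕ} (hR : R ≤ q)
    (hl : leader f q ∉ e.faulty) (hS : e.KnownHeight q h) (hU : e.QuorumHeightLE q h) :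
    ∃ P B, P.IsParentOf B ∧ B.round = q ∧ e.SeenByHonest (e.roundStart (q + 1)) B ∧
      P.height = h ∧ (P = Block.genesis ∨ e.HasQuorum P ∧ P.round < q) ∧
      e.HasQuorum B := by
  have he := w.valid
  obtain ⟨B, hB⟩ := he.exists_isSoleProposal (w.one_le.trans hR) hl
  obtain ⟨P, hPB, -, hP, hPq, -⟩ := hB.exists_parent he w.faulty_card
  have hPh := height_of_isParentOf hPB
  obtain ⟨C, hC, hCh⟩ := hS _ hl
  have hCP := hP.2 C hC
  have hPle : P.height ≤ h := by
    rcases hPq with rfl | ⟨h1, h2⟩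
    · exact Nat.zero_le _
    · exact hU P h1 h2
  have hseen := he.seenByHonest_of_quorumHeightLE w.faulty_card (w.one_le.trans hR)
    (w.gst_le_roundStart hR) hB hU (by omega)
  refine ⟨P, B, hPB, hB.round_eq, hseen, by omega, hPq, ?_⟩
  rcases he.hasQuorumBefore (hseen.certified w.faulty_card hl) with rfl | hq
  · simp only [Block.height] at hPh
    omega
  · exact hq.hasQuorum

/-- Consecutive settled rounds with honest leaders yield adjacent blocks. -/
theorem exists_child_of_honest_leader (w : e.CrashPeriod R N) {B : Block f Txn}
    (hR : R ≤ B.round) (hN : B.round < N) (hl : leader f (B.round + 1) ∉ e.faulty)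
    (hs : e.Settled B.round) (hB : e.HasQuorum B) :
    ∃ C, B.IsParentOf C ∧ C.round = B.round + 1 ∧
      e.SeenByHonest (e.roundStart (C.round + 1)) C ∧ e.HasQuorum C := by
  have he := w.valid
  obtain ⟨h, hS, hU⟩ := hs
  obtain ⟨hseen, hlt⟩ := w.seenByHonest_of_hasQuorum hR hN hS hU hB
  have hS' := hseen.knownHeight he w.faulty_card (w.gst_le_roundStart hR)
    (w.isSoleProposal hR hN hB)
  have hU' : e.QuorumHeightLE (B.round + 1) B.height := fun D hD hDr => by
    rcases Nat.lt_succ_iff_lt_or_eq.1 hDr with h1 | h1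
    · exact (hU D hD h1).trans hlt.le
    · rw [he.hasQuorum_unique w.faulty_card hD hB h1]
  obtain ⟨P, C, hPC, hCr, hCs, hPh, hP, hCq⟩ :=
    w.exists_block_of_honest_leader (hR.trans (Nat.le_succ _)) hl hS' hU'
  -- Blocks of rounds before that of `B` are too low to be the parent, so it is the quorum block of
  -- the round of `B`.
  have hPB : P = B := by
    rcases hP with rfl | ⟨hPq, hPr⟩
    · simp only [Block.height] at hPh
      omega
    · rcases Nat.lt_succ_iff_lt_or_eq.1 hPr with h1 | h1
      · have := hU P hPq h1
        omega
      · exact he.hasQuorum_unique w.faulty_card hPq hB h1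
  subst hPB
  exact ⟨C, hPC, hCr, by rwa [hCr], hCq⟩

/-- If fewer than `f` replicas are faulty, then at the end of the period every honest replica has
strong committed all blocks committed by then. -/
theorem strongCommitted (w : e.CrashPeriod R N) (hN : R + (3 * f + 1) + 2 ≤ N)
    (hc : e.faulty.card < f) {i j : Replica f} (hj : j ∉ e.faulty) {t : ℝ}
    (ht : t ≤ e.roundStart N) {A : Block f Txn} (hA : e.Committed i t A) :
    e.StrongCommitted j (e.roundStart N) (2 * f - e.faulty.card) A := by
  have he := w.valid
  have hmono := he.roundStart_strictMono.monotone
  have hx : 2 * f - e.faulty.card + f + 1 = 3 * f + 1 - e.faulty.card := by omega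
  obtain ⟨P, B, C, hBA, hPB, hBC, hr, hr', hP, hB, hC⟩ := hA
  obtain ⟨a, b, hRa, hab, hb, hla, hlb, hlb1, hlb2⟩ := exists_honest_leaders hc R
  have hset : ∀ q, b ≤ q → q ≤ N → e.Settled q := fun q hq hqN =>
    w.settled_of_le (hRa.le.trans (Nat.le_succ a)) (by omega) hqN
      (w.settled_of_honest_leader hRa (by omega) hla)
  have hBq : e.HasQuorum B := ((he.hasQuorumBefore hB).resolve_left
    (Block.ne_genesis_of_round_pos (by omega))).hasQuorum
  have hCb := (he.hasQuorumBefore hC).resolve_left (Block.ne_genesis_of_round_pos (by omega))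
  have hCN : C.round < N := by
    obtain ⟨k, hk, ⟨μ, s, hs, hv⟩, -⟩ := exists_mem_inter_of_quorums hc.le hCb hCb
    exact he.lt_of_inRound (he.voteRule hk hv).1 (hs.trans_le ht)
  have hPq : P = Block.genesis ∨ e.HasQuorum P :=
    (he.hasQuorumBefore hP).imp_right HasQuorumBefore.hasQuorum
  -- With `b < B.round` even `P` has round at least `b`, so the whole triple lies in settled rounds.
  -- Otherwise `B.round < b + 1`, and the block of round `b + 1` is at least as high as `B`.
  rcases Nat.lt_or_ge b B.round with hbB | hbB
  · have hP' : e.HasQuorum P :=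
      hPq.resolve_left (Block.ne_genesis_of_round_pos (by omega))
    have hend : ∀ D, e.HasQuorum D → b ≤ D.round → D.round < N →
        2 * f - e.faulty.card + f + 1 ≤ (e.endorsers j (e.roundStart N) B.height D).ncard := by
      intro D hD h1 h2
      obtain ⟨h, hS, hU⟩ := hset D.round h1 h2.le
      rw [hx]
      exact ((w.seenByHonest_of_hasQuorum (by omega) h2 hS hU hD).1.mono
        (hmono h2)).le_endorsers hj _
    exact ⟨P, B, C, hBA, hPB, hBC, hr, hr', hend P hP' (by omega) (by omega),
      hend B hBq (by omega) (by omega), hend C hCb.hasQuorum (by omega) hCN⟩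
  · obtain ⟨h, hS, hU⟩ := hset b le_rfl (by omega)
    obtain ⟨-, D, -, hDr, hDs, -, -, hD⟩ :=
      w.exists_block_of_honest_leader (by omega) hlb hS hU
    subst hDr
    obtain ⟨E, hDE, hEr, hEs, hE⟩ := w.exists_child_of_honest_leader (by omega) (by omega) hlb1
      (hset _ le_rfl (by omega)) hD
    obtain ⟨G, hEG, hGr, hGs, -⟩ := w.exists_child_of_honest_leader (by omega) (by omega)
      (by rwa [hEr]) (hset _ (by omega) (by omega)) hE
    have hEB : E.Extends B :=
      he.extends_of_height_le hc.le hPB hBC hr hr' hPq hBq hCb.hasQuorum hE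
        (he.height_le_of_round_lt hc.le hBq hE (by omega))
    refine ⟨D, E, G, hEB.trans hBA, hDE, hEG, hEr, hGr, ?_, ?_, ?_⟩ <;> rw [hx]
    · exact (hDs.mono (hmono (by omega))).le_endorsers hj _
    · exact (hEs.mono (hmono (by omega))).le_endorsers hj _
    · exact (hGs.mono (hmono (by omega))).le_endorsers hj _

end CrashPeriod

/-! ### From regular commits to strong commits -/

theorem Certified.le_endorsers {i : Replica f} {t : ℝ} {B : Block f Txn}
    (h : e.Certified i t B) (k : ℕ) : 2 * f + 1 ≤ (e.endorsers i t k B).ncard := by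
  rcases h with rfl | h
  · have : e.endorsers i t k Block.genesis = Set.univ :=
      Set.eq_univ_of_forall fun j => Or.inl rfl
    rw [this, Set.ncard_univ, Nat.card_eq_fintype_card, Fintype.card_fin]
    omega
  · refine h.trans (Set.ncard_le_ncard ?_ (Set.toFinite _))
    rintro j ⟨μ, hμ⟩
    exact Or.inr ⟨B, μ, hμ, Or.inl rfl⟩

/-- A committed block is `f`-strong committed. -/
theorem Committed.strongCommitted {i : Replica f} {t : ℝ} {A : Block f Txn}
    (h : e.Committed i t A) {x : ℕ} (hx : x ≤ f) : e.StrongCommitted i t x A := by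
  obtain ⟨P, B, C, hBA, hPB, hBC, hr, hr', hP, hB, hC⟩ := h
  have hle : x + f + 1 ≤ 2 * f + 1 := by omega
  exact ⟨P, B, C, hBA, hPB, hBC, hr, hr', hle.trans (hP.le_endorsers _),
    hle.trans (hB.le_endorsers _), hle.trans (hC.le_endorsers _)⟩

theorem Valid.committed_forward (he : e.Valid) {i j : Replica f} (hi : i ∉ e.faulty)
    (hj : j ∉ e.faulty) {t t' : ℝ} (ht : max e.GST t + e.Δ ≤ t') {A : Block f Txn}
    (h : e.Committed i t A) : e.Committed j t' A := by
  obtain ⟨P, B, C, hBA, hPB, hBC, hr, hr', hP, hB, hC⟩ := h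
  exact ⟨P, B, C, hBA, hPB, hBC, hr, hr', hP.imp fun _ _ => he.seesVote_forward hi hj ht,
    hB.imp fun _ _ => he.seesVote_forward hi hj ht, hC.imp fun _ _ => he.seesVote_forward hi hj ht⟩

end Execution

end SFTStreamlet

theorem mainTheorem5 {f : ℕ} {Txn : Type*} (e : SFTStreamlet.Execution f Txn) (he : e.Valid)
    (hc : e.faulty.card ≤ f)
    (R : ℕ) (hR : 1 ≤ R) (hGST : e.GST ≤ e.roundStart R)
    (τ : SFTStreamlet.Replica f → WithTop ℝ)
    (hcrash : ∀ i ∈ e.faulty, ∀ r, R ≤ r → r < R + ((3 * f + 1) + 2) →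
      e.FollowsRound i r (τ i)) :
    (∀ i, i ∉ e.faulty → ∀ A : SFTStreamlet.Block f Txn,
      e.Committed i (e.roundStart (R + ((3 * f + 1) + 2))) A →
      e.StrongCommitted i (e.roundStart (R + ((3 * f + 1) + 2))) (2 * f - e.faulty.card) A) ∧
    (∀ i, i ∉ e.faulty → ∀ j, j ∉ e.faulty → ∀ (A : SFTStreamlet.Block f Txn) (t : ℝ),
      t + e.Δ ≤ e.roundStart (R + ((3 * f + 1) + 2)) →
      e.Committed i t A →
      e.StrongCommitted j (e.roundStart (R + ((3 * f + 1) + 2))) (2 * f - e.faulty.card) A) := by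
  
  have w : e.CrashPeriod R (R + ((3 * f + 1) + 2)) := by
    refine ⟨he, hc, hR, hGST, fun r hr hrN => ?_⟩
    by_cases hl : SFTStreamlet.leader f r ∈ e.faulty
    · exact ⟨_, hcrash _ hl r hr hrN⟩
    · exact ⟨_, he.honest _ hl r (hR.trans hr)⟩
  -- For `c = f` the leader count breaks down, but the target `2f - c` is only `f`, which any
  -- regular commit meets.
  rcases hc.lt_or_eq with hlt | heq
  · refine ⟨fun i hi A hA => w.strongCommitted (by omega) hlt hi le_rfl hA,
      fun i _ j hj A t ht hA => w.strongCommitted (by omega) hlt hj ?_ hA⟩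
    linarith [he.delta_pos]
  · refine ⟨fun i _ A hA => hA.strongCommitted (by omega), fun i hi j hj A t ht hA =>
      (he.committed_forward hi hj ?_ hA).strongCommitted (by omega)⟩
    have h1 := he.roundStart_add_le (q := R) (r := R + ((3 * f + 1) + 2)) (by omega)
    have h2 := he.delta_pos
    rw [max_add]
    exact max_le (by linarith) ht
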